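/- Let $n\in\mathbb N$, $\mathcal H=L^2(\mathbb R^n)$ (complex, with inner product linear in the second variable), and for $X=(x,\xi)\in\Xi=\mathbb R^n\times\mathbb R^n$ let $W(X)$ be the unitary operator on $\mathcal H$ given by $$[W(x,\xi)u](y)=e^{i(y-x/2)\cdot\xi}\,u(y-x).$$ Let $\mathbf B^0(\mathcal H)$ be the set of all bounded operators $S$ on $\mathcal H$ for which the map $X\mapsto W(X)SW(-X)$ is continuous on $\Xi$ with respect to the operator norm. A self-adjoint operator $H$ in $\mathcal H$ is said to be affiliated to $\mathbf B^0(\mathcal H)$ if $(H-z)^{-1}\in\mathbf B^0(\mathcal H)$ for every $z$ in the resolvent set of $H$ (which contains $\mathbb C\setminus\mathbb R$). Let $a=(a_{jk})_{j,k=1}^n$ be a function from $\mathbb R^n$ to the Hermitian $n\times n$ matrices, with entries in $L^1_{\rm loc}(\mathbb R^n)$ and with $a(x)$ positive definite for almost every $x$. Assume that the quadratic form $$q^{(0)}_a(u)=\int_{\mathbb R^n}\sum_{j,k=1}^n a_{jk}(x)\,\overline{(\partial_j u)(x)}\,(\partial_k u)(x)\,dx,\qquad u\in C_c^\infty(\mathbb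 R^n),$$ is closable in $\mathcal H$. Let $\mathcal G_a\subset\mathcal H$ be the completion of $C_c^\infty(\mathbb R^n)$ in the norm $\|u\|_a=(q^{(0)}_a(u)+\|u\|^2)^{1/2}$, let $q_a$ be the extension of $q_a^{(0)}$ to a closed form on $\mathcal G_a$ (with $q_a(\cdot,\cdot)$ its sesquilinear version), and let $H_a=\sum_{j,k}P_ja_{jk}(Q)P_k$ be the operator associated with $q_a$: its domain is the set of those $u\in\mathcal G_a$ for which there is $f\in\mathcal H$ with $q_a(h,u)=\langle h,f\rangle$ for all $h\in\mathcal G_a$, and then $H_au=f$. Assume that there is a constant $c'\in\mathbb R$ with $a(x)\le c'\,\mathrm{id}$ for almost every $x\in\mathbb R^n$, and that there is a continuous function $C:\mathbb R^n\to(0,\infty)$ with $C(0)=1$ such that, for every $x\in\mathbb R^n$, $$a(z+x)\le C(x)\,a(z)\qquad\text{for almost every } z\in\mathbb R^n,$$ the inequalities being those between Hermitian matrices. Then $W(X)\mathcal G_a\subset\mathcal G_a$ for all $X\in\Xi$, and $H_a$ is self-adjoint and affiliated to $\mathbf B^0(\mathcal H)$. -/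

import Mathlib

open MeasureTheory Filter Topology
open scoped ContDiff ComplexConjugate ComplexOrder

namespace PhaseSpace

/-- The configuration space `ℝⁿ`. Its dual is identified with `ℝⁿ` through the inner product. -/
abbrev Config (n : ℕ) : Type := EuclideanSpace ℝ (Fin n)

/-- The phase space `Ξ = ℝⁿ × ℝⁿ`, with points `X = (x, ξ)`. -/
abbrev Phase (n : ℕ) : Type := Config n × Config n

/-- The complex Hilbert space `L²(ℝⁿ)`. -/
abbrev L2 (n : ℕ) : Type := Lp ℂ 2 (volume : Measure (Config n))

/-! ### The operators `W(X)` and the C*-algebra `B⁰` -/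

/-- The function `y ↦ exp(i (y - x/2)·ξ) u(y - x)`. -/
noncomputable def weylFun {n : ℕ} (X : Phase n) (u : Config n → ℂ) (y : Config n) : ℂ :=
  Complex.exp (Complex.I * ((inner ℝ (y - (1 / 2 : ℝ) • X.1) X.2 : ℝ) : ℂ)) * u (y - X.1)

theorem norm_weylFun {n : ℕ} (X : Phase n) (u : Config n → ℂ) (y : Config n) :
    ‖weylFun X u y‖ = ‖u (y - X.1)‖ := by
  rw [weylFun, norm_mul, mul_comm Complex.I, Complex.norm_exp_ofReal_mul_I, one_mul]

theorem memLp_weylFun {n : ℕ} (X : Phase n) (u : L2 n) :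
    MemLp (weylFun X u) 2 (volume : Measure (Config n)) := by
  have h : MemLp (fun y => u (y - X.1)) 2 (volume : Measure (Config n)) :=
    (Lp.memLp u).comp_measurePreserving (measurePreserving_sub_right volume X.1)
  refine h.of_le ?_ (Eventually.of_forall fun y => (norm_weylFun X u y).le)
  refine AEStronglyMeasurable.mul ?_ h.aestronglyMeasurable
  exact Continuous.aestronglyMeasurable (by fun_prop)

/-- The operator `W(x, ξ)` on `L²(ℝⁿ)`:
`[W(x, ξ) u](y) = exp(i (y - x/2)·ξ) u(y - x)`. -/
noncomputable def weyl {n : ℕ} (X : Phase n) : L2 n →L[ℂ] L2 n :=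
  LinearMap.mkContinuous
    { toFun := fun u => (memLp_weylFun X u).toLp (weylFun X u)
      map_add' := fun u v => by
        rw [← MemLp.toLp_add]
        refine MemLp.toLp_congr _ _ ?_
        filter_upwards [(measurePreserving_sub_right volume X.1).quasiMeasurePreserving.ae
          (Lp.coeFn_add u v)] with y hy
        simp only [weylFun, Pi.add_apply] at hy ⊢
        rw [hy]; ring
      map_smul' := fun c u => by
        rw [RingHom.id_apply, ← MemLp.toLp_const_smul]
        refine MemLp.toLp_congr _ _ ?_
        filter_upwards [(measurePreserving_sub_right volume X.1).quasiMeasurePreserving.ae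
          (Lp.coeFn_smul c u)] with y hy
        simp only [weylFun, Pi.smul_apply, smul_eq_mul] at hy ⊢
        rw [hy]; ring }
    1 (fun u => by
      rw [one_mul]
      change ‖(memLp_weylFun X u).toLp (weylFun X u)‖ ≤ ‖u‖
      rw [Lp.norm_toLp, Lp.norm_def]
      refine ENNReal.toReal_mono (Lp.eLpNorm_ne_top u) (le_of_eq ?_)
      rw [← eLpNorm_comp_measurePreserving (Lp.aestronglyMeasurable u)
        (measurePreserving_sub_right volume X.1)]
      exact eLpNorm_congr_norm_ae (Eventually.of_forall fun y => norm_weylFun X u y))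

/-- `T_X(S) = W(X) S W(-X)`. -/
noncomputable def conjWeyl {n : ℕ} (X : Phase n) (S : L2 n →L[ℂ] L2 n) : L2 n →L[ℂ] L2 n :=
  weyl X ∘L S ∘L weyl (-X)

/-- The algebra `B⁰` of the bounded operators `S` for which `X ↦ T_X(S)` is continuous with
respect to the operator norm. -/
def B0 (n : ℕ) : Set (L2 n →L[ℂ] L2 n) :=
  {S | Continuous fun X : Phase n => conjWeyl X S}

/-! ### Resolvents and affiliation -/

/-- `R` is the resolvent `(T - z)⁻¹` of the unbounded operator `T`: it maps into the domain of `T`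
and is a bounded two-sided inverse of `T - z`. -/
def IsResolventAt {H : Type*} [NormedAddCommGroup H] [InnerProductSpace ℂ H]
    (T : H →ₗ.[ℂ] H) (z : ℂ) (R : H →L[ℂ] H) : Prop :=
  (∀ f : H, ∃ u : T.domain, (u : H) = R f ∧ T u - z • (u : H) = f) ∧
    ∀ u : T.domain, R (T u - z • (u : H)) = u

/-- `T` is a self-adjoint operator affiliated to `A`: the resolvent `(T - z)⁻¹` exists for every
nonreal `z`, and for every `z` at which it exists it belongs to `A`. -/
def IsAffiliated {H : Type*} [NormedAddCommGroup H] [InnerProductSpace ℂ H] [CompleteSpace H]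
    (T : H →ₗ.[ℂ] H) (A : Set (H →L[ℂ] H)) : Prop :=
  IsSelfAdjoint T ∧ (∀ z : ℂ, z.im ≠ 0 → ∃ R : H →L[ℂ] H, IsResolventAt T z R) ∧
    ∀ (z : ℂ) (R : H →L[ℂ] H), IsResolventAt T z R → R ∈ A

/-! ### The quadratic form -/

/-- A coefficient matrix `a = (a_{jk})` on `ℝⁿ`: its entries are locally integrable and it is
(Hermitian) positive definite almost everywhere. -/
structure CoeffField (n : ℕ) where
  toFun : Config n → Matrix (Fin n) (Fin n) ℂ
  locallyIntegrable : ∀ j k, LocallyIntegrable (fun x => toFun x j k) volume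
  posDef : ∀ᵐ x ∂(volume : Measure (Config n)), (toFun x).PosDef

instance {n : ℕ} : CoeFun (CoeffField n) fun _ => Config n → Matrix (Fin n) (Fin n) ℂ :=
  ⟨CoeffField.toFun⟩

/-- The partial derivative `∂_j u`. -/
noncomputable def partialDeriv {n : ℕ} (j : Fin n) (u : Config n → ℂ) (x : Config n) : ℂ :=
  fderiv ℝ u x (EuclideanSpace.single j 1)

/-- The space `C_c^∞(ℝⁿ)` of smooth compactly supported complex functions. -/
def testFunctions (n : ℕ) : Submodule ℂ (Config n → ℂ) where
  carrier := {u | ContDiff ℝ ∞ u ∧ HasCompactSupport u}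
  add_mem' := fun hu hv => ⟨hu.1.add hv.1, hu.2.add hv.2⟩
  zero_mem' := ⟨contDiff_const, HasCompactSupport.zero⟩
  smul_mem' := fun c _ hu => ⟨contDiff_const.smul hu.1, hu.2.smul_left (f := fun _ => c)⟩

/-- The inclusion of `C_c^∞(ℝⁿ)` in `L²(ℝⁿ)`. -/
noncomputable def testToL2 (n : ℕ) : testFunctions n →ₗ[ℂ] L2 n where
  toFun u := (u.2.1.continuous.memLp_of_hasCompactSupport u.2.2).toLp (u : Config n → ℂ)
  map_add' _ _ := rfl
  map_smul' _ _ := rfl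

/-- The sesquilinear form `∫ ∑_{j,k} a_{jk}(x) conj((∂_j u)(x)) (∂_k v)(x) dx`
on `C_c^∞(ℝⁿ)`. -/
noncomputable def sesqForm {n : ℕ} (a : CoeffField n) (u v : testFunctions n) : ℂ :=
  ∫ x, ∑ j, ∑ k, a x j k * conj (partialDeriv j u x) * partialDeriv k v x

/-- The quadratic form `q_a⁽⁰⁾(u) = ∫ ∑_{j,k} a_{jk} conj(∂_j u) ∂_k u` (a real number). -/
noncomputable def quadForm {n : ℕ} (a : CoeffField n) (u : testFunctions n) : ℝ :=
  (sesqForm a u u).re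

/-- The quadratic form `q_a⁽⁰⁾` is closable in `L²(ℝⁿ)`: if `u_m → 0` in `L²` and
`q(u_m - u_l) → 0` as `m, l → ∞`, then `q(u_m) → 0`. -/
def IsClosable {n : ℕ} (a : CoeffField n) : Prop :=
  ∀ u : ℕ → testFunctions n,
    Tendsto (fun m => testToL2 n (u m)) atTop (𝓝 0) →
    Tendsto (fun p : ℕ × ℕ => quadForm a (u p.1 - u p.2)) atTop (𝓝 0) →
    Tendsto (fun m => quadForm a (u m)) atTop (𝓝 0)

/-! ### Elementary properties of the form on test functions -/

theorem partialDeriv_add {n : ℕ} (j : Fin n) (u v : testFunctions n) (x : Config n) :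
    partialDeriv j (u + v : testFunctions n) x = partialDeriv j u x + partialDeriv j v x := by
  have hu := (u.2.1.differentiable (by simp)).differentiableAt (x := x)
  have hv := (v.2.1.differentiable (by simp)).differentiableAt (x := x)
  simp only [partialDeriv, Submodule.coe_add]
  rw [fderiv_add hu hv]; rfl

theorem partialDeriv_smul {n : ℕ} (j : Fin n) (c : ℂ) (u : testFunctions n) (x : Config n) :
    partialDeriv j (c • u : testFunctions n) x = c * partialDeriv j u x := by
  have hu := (u.2.1.differentiable (by simp)).differentiableAt (x := x)
  simp only [partialDeriv, Submodule.coe_smul]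
  rw [fderiv_const_smul hu]; rfl

theorem continuous_partialDeriv {n : ℕ} (j : Fin n) (u : testFunctions n) :
    Continuous (partialDeriv j (u : Config n → ℂ)) :=
  (u.2.1.continuous_fderiv (by simp)).clm_apply continuous_const

theorem hasCompactSupport_partialDeriv {n : ℕ} (j : Fin n) (u : testFunctions n) :
    HasCompactSupport (partialDeriv j (u : Config n → ℂ)) :=
  u.2.2.fderiv_apply ℝ _

theorem integrable_sesqForm {n : ℕ} (a : CoeffField n) (u v : testFunctions n) :
    Integrable (fun x => ∑ j, ∑ k, a x j k * conj (partialDeriv j u x) * partialDeriv k v x)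
      volume := by
  refine integrable_finsetSum _ fun j _ => integrable_finsetSum _ fun k _ => ?_
  have h := (a.locallyIntegrable j k).integrable_smul_left_of_hasCompactSupport
    (g := fun x => conj (partialDeriv j (u : Config n → ℂ) x)
      * partialDeriv k (v : Config n → ℂ) x)
    ((Complex.continuous_conj.comp (continuous_partialDeriv j u)).mul
      (continuous_partialDeriv k v)) (hasCompactSupport_partialDeriv k v).mul_left
  refine h.congr (Eventually.of_forall fun x => ?_)
  simp only [smul_eq_mul]; ring

theorem sesqForm_conj_symm {n : ℕ} (a : CoeffField n) (u v : testFunctions n) :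
    conj (sesqForm a v u) = sesqForm a u v := by
  rw [sesqForm, sesqForm, ← integral_conj]
  refine integral_congr_ae ?_
  filter_upwards [a.posDef] with x hx
  simp only [map_sum, map_mul, Complex.conj_conj]
  rw [Finset.sum_comm]
  refine Finset.sum_congr rfl fun j _ => Finset.sum_congr rfl fun k _ => ?_
  have h : conj (a x k j) = a x j k := hx.isHermitian.apply j k
  rw [h]; ring

theorem sesqForm_add_left {n : ℕ} (a : CoeffField n) (u v w : testFunctions n) :
    sesqForm a (u + v) w = sesqForm a u w + sesqForm a v w := by
  simp only [sesqForm]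
  rw [← integral_add (integrable_sesqForm a u w) (integrable_sesqForm a v w)]
  refine integral_congr_ae (Eventually.of_forall fun x => ?_)
  simp only [partialDeriv_add, map_add, mul_add, add_mul, Finset.sum_add_distrib]

theorem sesqForm_smul_left {n : ℕ} (a : CoeffField n) (c : ℂ) (u v : testFunctions n) :
    sesqForm a (c • u) v = conj c * sesqForm a u v := by
  simp only [sesqForm]
  rw [← integral_const_mul]
  refine integral_congr_ae (Eventually.of_forall fun x => ?_)
  simp only [partialDeriv_smul, map_mul, Finset.mul_sum]
  refine Finset.sum_congr rfl fun j _ => Finset.sum_congr rfl fun k _ => ?_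
  ring

theorem quadForm_nonneg {n : ℕ} (a : CoeffField n) (u : testFunctions n) : 0 ≤ quadForm a u := by
  have h0 : quadForm a u = ∫ x, (∑ j, ∑ k, a x j k * conj (partialDeriv j (u : Config n → ℂ) x)
      * partialDeriv k (u : Config n → ℂ) x).re :=
    (integral_re (integrable_sesqForm a u u)).symm
  rw [h0]
  refine integral_nonneg_of_ae ?_
  filter_upwards [a.posDef] with x hx
  have h := (hx.posSemidef.dotProduct_mulVec_nonneg
    (fun j => partialDeriv j (u : Config n → ℂ) x))
  have h' := (Complex.le_def.1 h).1
  simp only [dotProduct, Matrix.mulVec, Finset.mul_sum, Pi.star_apply, Complex.zero_re] at h'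
  refine h'.trans (le_of_eq ?_)
  congr 1
  refine Finset.sum_congr rfl fun j _ => Finset.sum_congr rfl fun k _ => ?_
  simp only [RCLike.star_def]; ring

/-! ### The form domain and the operator -/

/-- The space `C_c^∞(ℝⁿ)` endowed with the inner product
`⟨u, v⟩_a = q_a⁽⁰⁾(u, v) + ⟨u, v⟩`, whose norm is `‖u‖_a = (q_a⁽⁰⁾(u) + ‖u‖²)^{1/2}`. -/
def FormCore {n : ℕ} (_a : CoeffField n) : Type := testFunctions n

instance {n : ℕ} (a : CoeffField n) : AddCommGroup (FormCore a) :=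
  inferInstanceAs (AddCommGroup (testFunctions n))

instance {n : ℕ} (a : CoeffField n) : Module ℂ (FormCore a) :=
  inferInstanceAs (Module ℂ (testFunctions n))

/-- An element of `FormCore a`, seen as a test function. -/
def FormCore.toTest {n : ℕ} (a : CoeffField n) : FormCore a ≃ₗ[ℂ] testFunctions n :=
  LinearEquiv.refl ℂ (testFunctions n)

/-- The inner product `⟨u, v⟩_a`. -/
noncomputable instance {n : ℕ} (a : CoeffField n) : PreInnerProductSpace.Core ℂ (FormCore a) where
  inner u v := sesqForm a (FormCore.toTest a u) (FormCore.toTest a v)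
    + inner ℂ (testToL2 n (FormCore.toTest a u)) (testToL2 n (FormCore.toTest a v))
  conj_inner_symm u v := by
    rw [map_add, sesqForm_conj_symm, inner_conj_symm]
  re_inner_nonneg u := by
    rw [map_add]
    exact add_nonneg (quadForm_nonneg a _) inner_self_nonneg
  add_left u v w := by
    simp only [map_add, sesqForm_add_left, inner_add_left]; ring
  smul_left u v c := by
    simp only [map_smul, sesqForm_smul_left, inner_smul_left]; ring

noncomputable instance {n : ℕ} (a : CoeffField n) : SeminormedAddCommGroup (FormCore a) :=
  InnerProductSpace.Core.toSeminormedAddCommGroup (𝕜 := ℂ)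

noncomputable instance {n : ℕ} (a : CoeffField n) : InnerProductSpace ℂ (FormCore a) :=
  InnerProductSpace.ofCore _

theorem formCore_inner {n : ℕ} (a : CoeffField n) (u v : FormCore a) :
    inner ℂ u v = sesqForm a (FormCore.toTest a u) (FormCore.toTest a v)
      + inner ℂ (testToL2 n (FormCore.toTest a u)) (testToL2 n (FormCore.toTest a v)) := rfl

theorem formCore_norm_sq {n : ℕ} (a : CoeffField n) (u : FormCore a) :
    ‖u‖ ^ 2 = quadForm a (FormCore.toTest a u) + ‖testToL2 n (FormCore.toTest a u)‖ ^ 2 := by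
  rw [← inner_self_eq_norm_sq (𝕜 := ℂ) u,
    ← inner_self_eq_norm_sq (𝕜 := ℂ) (testToL2 n (FormCore.toTest a u)),
    formCore_inner, map_add]
  rfl

/-- The inclusion of `(C_c^∞(ℝⁿ), ‖·‖_a)` in `L²(ℝⁿ)`, a contraction. -/
noncomputable def coreToL2 {n : ℕ} (a : CoeffField n) : FormCore a →L[ℂ] L2 n :=
  LinearMap.mkContinuous (testToL2 n ∘ₗ (FormCore.toTest a).toLinearMap) 1 (fun u => by
    rw [one_mul]
    refine abs_le_of_sq_le_sq' ?_ (norm_nonneg _) |>.2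
    rw [formCore_norm_sq]
    exact le_add_of_nonneg_left (quadForm_nonneg a _))

/-- The Hilbert space `𝒢_a` obtained by completing `C_c^∞(ℝⁿ)` with respect to `‖·‖_a`. -/
abbrev FormSpace {n : ℕ} (a : CoeffField n) : Type := UniformSpace.Completion (FormCore a)

/-- The canonical map `𝒢_a → L²(ℝⁿ)`, the continuous extension of the inclusion of
`C_c^∞(ℝⁿ)` (injective when the form is closable). -/
noncomputable def formEmbedding {n : ℕ} (a : CoeffField n) : FormSpace a →L[ℂ] L2 n :=
  (coreToL2 a).fromCompletion

/-- The form domain `𝒢_a`, seen as a subspace of `L²(ℝⁿ)`. -/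
noncomputable def formDomain {n : ℕ} (a : CoeffField n) : Submodule ℂ (L2 n) :=
  LinearMap.range (formEmbedding a : FormSpace a →ₗ[ℂ] L2 n)

/-- The closed form `q_a` on `𝒢_a`, in sesquilinear version: the continuous extension of
`q_a⁽⁰⁾`, given by `q_a(g, h) = ⟨g, h⟩_a - ⟨g, h⟩`. -/
noncomputable def closedForm {n : ℕ} (a : CoeffField n) (g h : FormSpace a) : ℂ :=
  inner ℂ g h - inner ℂ (formEmbedding a g) (formEmbedding a h)

theorem formEmbedding_coe {n : ℕ} (a : CoeffField n) (u : FormCore a) :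
    formEmbedding a (u : FormSpace a) = testToL2 n (FormCore.toTest a u) :=
  (coreToL2 a).fromCompletion_apply_coe u

theorem closedForm_coe {n : ℕ} (a : CoeffField n) (u v : FormCore a) :
    closedForm a (u : FormSpace a) (v : FormSpace a) =
      sesqForm a (FormCore.toTest a u) (FormCore.toTest a v) := by
  rw [closedForm, UniformSpace.Completion.inner_coe, formEmbedding_coe, formEmbedding_coe,
    formCore_inner, add_sub_cancel_right]

/-- The graph of `H_a`: the pairs `(u, f)` with `u ∈ 𝒢_a` and
`q_a(h, u) = ⟨h, f⟩` for all `h ∈ 𝒢_a`. -/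
noncomputable def operatorGraph {n : ℕ} (a : CoeffField n) : Submodule ℂ (L2 n × L2 n) where
  carrier := {p | ∃ g : FormSpace a, formEmbedding a g = p.1 ∧
    ∀ h : FormSpace a, closedForm a h g = inner ℂ (formEmbedding a h) p.2}
  add_mem' := by
    rintro p p' ⟨g, hg, H⟩ ⟨g', hg', H'⟩
    refine ⟨g + g', by rw [map_add, hg, hg', Prod.fst_add], fun h => ?_⟩
    rw [Prod.snd_add, inner_add_right, ← H h, ← H' h]
    simp only [closedForm, map_add, inner_add_right]; ring
  zero_mem' := ⟨0, by simp, fun h => by simp [closedForm]⟩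
  smul_mem' := by
    rintro c p ⟨g, hg, H⟩
    refine ⟨c • g, by rw [map_smul, hg, Prod.smul_fst], fun h => ?_⟩
    rw [Prod.smul_snd, inner_smul_right, ← H h]
    simp only [closedForm, map_smul, inner_smul_right]; ring

/-- The operator `H_a = ∑ P_j a_{jk}(Q) P_k` associated with the closed form `q_a`: its domain
consists of the `u ∈ 𝒢_a` for which there is `f ∈ L²(ℝⁿ)` with `q_a(h, u) = ⟨h, f⟩` for all
`h ∈ 𝒢_a`, and then `H_a u = f`. -/
noncomputable def ellipticOperator {n : ℕ} (a : CoeffField n) : L2 n →ₗ.[ℂ] L2 n :=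
  (operatorGraph a).toLinearPMap

end PhaseSpace

namespace PhaseSpace

/-! ### Operators determined by a bounded self-adjoint operator -/

section Hilbert

variable {G H : Type*} [NormedAddCommGroup G] [InnerProductSpace ℂ G] [CompleteSpace G]
  [NormedAddCommGroup H] [InnerProductSpace ℂ H] [CompleteSpace H]

/-! Let `J : 𝒢_a → L²` be the canonical map. Unwinding the definition of the operator gives `(H_a +
1)⁻¹ = J J*`, which is bounded, self-adjoint and injective (the test functions are dense). Hence
`H_a` is self-adjoint, and everything reduces to the regularity of this single resolvent.

On a test function, `W(x, ξ)` translates by `x` and turns `∇u` into `∇u + iξu`, up to a phase. The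
comparison `a(z + x) ≤ C(x) a(z)` absorbs the translation, and `a ≤ c'` controls the term `iξu`.
Thus `W(X)` lifts to a bounded operator `V_X` on `𝒢_a` with `J V_X = W(X) J`, which gives the
invariance of the form domain, and `‖V_X‖²` is at most `weylBound c' C X`, which tends to `1` as `X
→ 0`.

The lift need not be unitary for the form norm, but its inverse `V_{-X}` obeys the same kind of
bound, so `V_X V_X* → 1` in norm (`norm_comp_adjoint_sub_one_le`). Since `W(X) J J* W(-X) - J J* = J
(V_X V_X* - 1) J*`, the resolvent at `-1` is norm continuous at the origin, hence everywhere because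
`T_X` is a contractive group action (`mem_B0_of_tendsto`). The other resolvents follow by the
resolvent identity and continuity of inversion (`IsResolventAt.mem_B0`). -/

theorem norm_le_of_abs_inner_self_le {T : H →L[ℂ] H} (hT : IsSelfAdjoint T) {K : ℝ} (hK : 0 ≤ K)
    (h : ∀ x, |(inner ℂ (T x) x).re| ≤ K * ‖x‖ ^ 2) : ‖T‖ ≤ K := by
  rw [T.norm_eq_iSup_rayleighQuotient hT.isSymmetric]
  refine ciSup_le fun x => ?_
  rw [ContinuousLinearMap.rayleighQuotient, abs_div, abs_sq]
  exact div_le_of_le_mul₀ (sq_nonneg _) hK (h x)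

open ContinuousLinearMap in
/-- A right invertible operator `V` with `‖V‖²` and `‖V⁻¹‖²` at most `1 + K` satisfies
`‖V V* - 1‖ ≤ K`. -/
theorem norm_comp_adjoint_sub_one_le {V U : G →L[ℂ] G} (hVU : V ∘L U = 1) {K : ℝ} (hK : 0 ≤ K)
    (hV : ‖V‖ ^ 2 ≤ 1 + K) (hU : ‖U‖ ^ 2 ≤ 1 + K) : ‖V ∘L adjoint V - 1‖ ≤ K := by
  have hself : IsSelfAdjoint (V ∘L adjoint V - 1) :=
    (IsSelfAdjoint.mul_star_self V).sub (IsSelfAdjoint.one _)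
  refine norm_le_of_abs_inner_self_le hself hK fun x => ?_
  have h1 : (inner ℂ ((V ∘L adjoint V - 1) x) x).re = ‖adjoint V x‖ ^ 2 - ‖x‖ ^ 2 := by
    rw [sub_apply, inner_sub_left, Complex.sub_re, comp_apply, ← adjoint_inner_right]
    change RCLike.re (inner ℂ (adjoint V x) (adjoint V x)) - RCLike.re (inner ℂ x x) = _
    rw [inner_self_eq_norm_sq, inner_self_eq_norm_sq]
  have h2 : ‖adjoint V x‖ ^ 2 ≤ (1 + K) * ‖x‖ ^ 2 := by
    calc ‖adjoint V x‖ ^ 2 ≤ (‖adjoint V‖ * ‖x‖) ^ 2 := by gcongr; exact le_opNorm _ _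
      _ = ‖V‖ ^ 2 * ‖x‖ ^ 2 := by rw [LinearIsometryEquiv.norm_map, mul_pow]
      _ ≤ _ := by gcongr
  have h3 : ‖x‖ ^ 2 ≤ (1 + K) * ‖adjoint V x‖ ^ 2 := by
    have hx : adjoint U (adjoint V x) = x := by
      rw [← comp_apply, ← adjoint_comp, hVU]
      exact DFunLike.congr_fun (star_one (G →L[ℂ] G)) x
    calc ‖x‖ ^ 2 = ‖adjoint U (adjoint V x)‖ ^ 2 := by rw [hx]
      _ ≤ (‖adjoint U‖ * ‖adjoint V x‖) ^ 2 := by gcongr; exact le_opNorm _ _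
      _ = ‖U‖ ^ 2 * ‖adjoint V x‖ ^ 2 := by rw [LinearIsometryEquiv.norm_map, mul_pow]
      _ ≤ _ := by gcongr
  rw [h1, abs_le]
  constructor
  · rcases le_total (‖x‖ ^ 2) (‖adjoint V x‖ ^ 2) with h | h
    · nlinarith [mul_nonneg hK (sq_nonneg ‖x‖)]
    -- Here `‖x‖² - ‖V*x‖² ≤ K ‖V*x‖² ≤ K ‖x‖²`: the bound on the inverse is used first, then the
    -- case assumption.
    · nlinarith [mul_le_mul_of_nonneg_left h hK]
  · linarith

variable {T : H →ₗ.[ℂ] H} {R : H →L[ℂ] H}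

/-- An operator `T` with `(T + 1)⁻¹ = R` bounded, self-adjoint and injective is self-adjoint. -/
theorem isSelfAdjoint_of_graph (hR : IsSelfAdjoint R) (hinj : Function.Injective R)
    (hT : ∀ u f, (u, f) ∈ T.graph ↔ u = R (f + u)) : IsSelfAdjoint T := by
  have hsymm : ∀ x y, inner ℂ (R x) y = inner ℂ x (R y) := hR.isSymmetric
  have hmem : ∀ f, (R f, f - R f) ∈ T.graph := fun f => by rw [hT, sub_add_cancel]
  have hdense : Dense (T.domain : Set H) := by
    rw [Submodule.dense_iff_topologicalClosure_eq_top,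
      Submodule.topologicalClosure_eq_top_iff, Submodule.eq_bot_iff]
    intro v hv
    -- The range of `R` lies in the domain, so `v` orthogonal to the domain gives `‖R v‖² = ⟨R (R
    -- v), v⟩ = 0`.
    refine hinj ?_
    rw [map_zero, ← inner_self_eq_zero (𝕜 := ℂ), ← hsymm]
    exact (Submodule.mem_orthogonal _ _).1 hv _ (LinearPMap.mem_domain_of_mem_graph (hmem (R v)))
  rw [LinearPMap.isSelfAdjoint_def]
  refine LinearPMap.eq_of_eq_graph ?_
  rw [LinearPMap.adjoint_graph_eq_graph_adjoint hdense]
  ext ⟨u, f⟩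
  rw [Submodule.mem_adjoint_iff, hT]
  simp only
  constructor
  · intro h
    refine ext_inner_left ℂ fun v => ?_
    have := h _ _ (hmem v)
    rw [inner_sub_left, hsymm, hsymm, sub_sub, sub_eq_zero] at this
    rw [this, map_add, inner_add_right, add_comm]
  · intro h p q hpq
    rw [hT] at hpq
    rw [sub_eq_zero]
    have h1 : inner ℂ (q + p) u = inner ℂ p (f + u) := by
      calc inner ℂ (q + p) u = inner ℂ (q + p) (R (f + u)) := by rw [← h]
        _ = inner ℂ p (f + u) := by rw [← hsymm, ← hpq]
    rw [inner_add_left, inner_add_right] at h1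
    exact add_right_cancel h1

-- The first resolvent identity between the points `-1` and `z`. Both orders of the product are
-- needed, here and in `IsResolventAt.eq_add'`, to obtain a two-sided inverse of `1 - (1 + z) R`.
omit [CompleteSpace H] in
theorem IsResolventAt.eq_add {z : ℂ} {S : H →L[ℂ] H}
    (hT : ∀ u f, (u, f) ∈ T.graph ↔ u = R (f + u)) (hS : IsResolventAt T z S) :
    S = R + (1 + z) • (R * S) := by
  ext f
  obtain ⟨u, hu, hf⟩ := hS.1 f
  have h := (hT _ _).1 (T.mem_graph u)
  have h2 : T u + (u : H) = f + (1 + z) • S f := by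
    rw [← hu, ← hf]; module
  rw [h2, hu, map_add, map_smul] at h
  exact h

omit [CompleteSpace H] in
theorem IsResolventAt.eq_add' {z : ℂ} {S : H →L[ℂ] H}
    (hT : ∀ u f, (u, f) ∈ T.graph ↔ u = R (f + u)) (hS : IsResolventAt T z S) :
    S = R + (1 + z) • (S * R) := by
  ext f
  obtain ⟨u, hu, hf⟩ := (T.mem_graph_iff).1 ((hT (R f) (f - R f)).2 (by rw [sub_add_cancel]))
  have h := hS.2 u
  simp only at hu hf
  have h2 : T u - z • (u : H) = f - (1 + z) • R f := by
    rw [hf, hu]; module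
  rw [h2, hu, map_sub, map_smul, sub_eq_iff_eq_add] at h
  exact h

/-- With `w = 1 + z`, formally `T - z = (1 - w R)(T + 1)`, so the resolvent is `R (1 - w R)⁻¹`. The
inverse exists because `w⁻¹` is nonreal and the spectrum of the self-adjoint `R` is real. -/
theorem exists_isResolventAt (hR : IsSelfAdjoint R)
    (hT : ∀ u f, (u, f) ∈ T.graph ↔ u = R (f + u)) {z : ℂ} (hz : z.im ≠ 0) :
    ∃ S : H →L[ℂ] H, IsResolventAt T z S := by
  have hw : (1 + z).im ≠ 0 := by simpa using hz
  have hw0 : 1 + z ≠ 0 := fun h => hw (by rw [h, Complex.zero_im])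
  have hunit : IsUnit (1 - (1 + z) • R) := by
    have h1 : (1 + z)⁻¹ ∉ spectrum ℂ R := fun h => by
      have := hR.im_eq_zero_of_mem_spectrum h
      rw [Complex.inv_im, div_eq_zero_iff, neg_eq_zero] at this
      exact this.elim hw fun h => hw0 (Complex.normSq_eq_zero.1 h)
    rw [spectrum.notMem_iff] at h1
    have h2 := (IsUnit.smul (Units.mk0 _ hw0) h1)
    rwa [Units.smul_def, Units.val_mk0, smul_sub, Algebra.algebraMap_eq_smul_one, smul_smul,
      mul_inv_cancel₀ hw0, one_smul] at h2
  obtain ⟨B, hB1, hB2⟩ := isUnit_iff_exists.1 hunit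
  refine ⟨R * B, fun f => ?_, fun u => ?_⟩
  · obtain ⟨u, hu, hf⟩ := (T.mem_graph_iff).1
      ((hT (R (B f)) (B f - R (B f))).2 (by rw [sub_add_cancel]))
    refine ⟨u, hu, ?_⟩
    have h := DFunLike.congr_fun hB1 f
    simp only at hu hf
    rw [hf, hu]
    refine Eq.trans ?_ h
    change _ = B f - (1 + z) • R (B f)
    module
  · have h := (hT _ _).1 (T.mem_graph u)
    -- Since `u = R (T u + u)`, the vector `T u - z u` is `(1 - w R)(T u + u)`, which `B` sends back
    -- to `T u + u`.
    have h2 := DFunLike.congr_fun hB2 (T u + u)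
    change B ((T u + u) - (1 + z) • R (T u + u)) = T u + u at h2
    rw [← h] at h2
    change R (B _) = _
    rw [h, ← h2]
    congr 2
    rw [h2, ← h]
    module

end Hilbert

/-! ### The group law of the Weyl operators -/

variable {n : ℕ}

theorem coeFn_weyl (X : Phase n) (u : L2 n) : weyl X u =ᵐ[volume] weylFun X u :=
  (memLp_weylFun X u).coeFn_toLp

/-- The shift by `x/2` in the phase makes the cocycle antisymmetric in `X` and `Y`. It therefore
vanishes for `Y = -X`, and it cancels under conjugation, so that `T_X` is a genuine action of the
additive group. -/
theorem weylFun_weylFun (X Y : Phase n) (u : Config n → ℂ) (y : Config n) :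
    weylFun X (weylFun Y u) y =
      Complex.exp (Complex.I * (((inner ℝ Y.1 X.2 - inner ℝ X.1 Y.2) / 2 : ℝ) : ℂ)) *
        weylFun (X + Y) u y := by
  simp only [weylFun, ← mul_assoc, ← Complex.exp_add, ← mul_add, ← Complex.ofReal_add, Prod.fst_add,
    Prod.snd_add]
  rw [sub_sub y X.1 Y.1]
  congr 4
  simp only [inner_sub_left, inner_add_right, inner_add_left, real_inner_smul_left, smul_add]
  ring

theorem weylFun_congr_ae (X : Phase n) {u v : Config n → ℂ} (h : u =ᵐ[volume] v) :
    weylFun X u =ᵐ[volume] weylFun X v := by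
  filter_upwards [(measurePreserving_sub_right volume X.1).quasiMeasurePreserving.ae h] with y hy
  rw [weylFun, weylFun, hy]

theorem weyl_weyl (X Y : Phase n) (u : L2 n) :
    weyl X (weyl Y u) =
      Complex.exp (Complex.I * (((inner ℝ Y.1 X.2 - inner ℝ X.1 Y.2) / 2 : ℝ) : ℂ)) •
        weyl (X + Y) u := by
  refine Lp.ext ?_
  filter_upwards [coeFn_weyl X (weyl Y u), weylFun_congr_ae X (coeFn_weyl Y u),
    coeFn_weyl (X + Y) u, Lp.coeFn_smul (Complex.exp (Complex.I *
      (((inner ℝ Y.1 X.2 - inner ℝ X.1 Y.2) / 2 : ℝ) : ℂ))) (weyl (X + Y) u)] with y h1 h2 h3 h4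
  rw [h1, h2, h4, Pi.smul_apply, h3, weylFun_weylFun, smul_eq_mul]

theorem weylFun_zero (u : Config n → ℂ) : weylFun 0 u = u := by
  ext y; simp [weylFun]

theorem weyl_zero (u : L2 n) : weyl 0 u = u := by
  refine Lp.ext ?_
  filter_upwards [coeFn_weyl 0 u] with y h
  rw [h, weylFun_zero]

theorem weyl_comp_neg (X : Phase n) : weyl X ∘L weyl (-X) = 1 := by
  ext1 u
  rw [ContinuousLinearMap.comp_apply, weyl_weyl]
  simp [weyl_zero]

theorem norm_weyl_le (X : Phase n) : ‖weyl X‖ ≤ 1 :=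
  LinearMap.mkContinuous_norm_le _ zero_le_one _

theorem norm_weyl_apply (X : Phase n) (u : L2 n) : ‖weyl X u‖ = ‖u‖ := by
  refine le_antisymm ((weyl X).le_of_opNorm_le (norm_weyl_le X) u |>.trans_eq (one_mul _)) ?_
  have h := DFunLike.congr_fun (weyl_comp_neg (-X)) u
  rw [neg_neg] at h
  calc ‖u‖ = ‖weyl (-X) (weyl X u)‖ := by rw [← ContinuousLinearMap.comp_apply, h]; rfl
    _ ≤ _ := (weyl (-X)).le_of_opNorm_le (norm_weyl_le _) _ |>.trans_eq (one_mul _)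

theorem adjoint_weyl (X : Phase n) : ContinuousLinearMap.adjoint (weyl X) = weyl (-X) := by
  have h := (ContinuousLinearMap.norm_map_iff_adjoint_comp_self (weyl X)).1 (norm_weyl_apply X)
  calc ContinuousLinearMap.adjoint (weyl X)
      = ContinuousLinearMap.adjoint (weyl X) ∘L (weyl X ∘L weyl (-X)) := by
        rw [weyl_comp_neg]; rfl
    _ = weyl (-X) := by rw [← ContinuousLinearMap.comp_assoc, h]; rfl

theorem conjWeyl_add (X Y : Phase n) (S : L2 n →L[ℂ] L2 n) :
    conjWeyl (X + Y) S = conjWeyl X (conjWeyl Y S) := by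
  ext1 u
  change _ = weyl X (weyl Y (S (weyl (-Y) (weyl (-X) u))))
  rw [weyl_weyl (-Y), weyl_weyl X, map_smul, map_smul, smul_smul, ← Complex.exp_add, ← neg_add_rev]
  simp only [Prod.fst_neg, Prod.snd_neg, inner_neg_neg]
  rw [← mul_add, ← Complex.ofReal_add]
  rw [show (inner ℝ Y.1 X.2 - inner ℝ X.1 Y.2) / 2 + (inner ℝ X.1 Y.2 - inner ℝ Y.1 X.2) / 2 = (0:ℝ) by
    ring]
  simp [conjWeyl]

theorem conjWeyl_mul (X : Phase n) (S S' : L2 n →L[ℂ] L2 n) :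
    conjWeyl X (S * S') = conjWeyl X S * conjWeyl X S' := by
  have h := weyl_comp_neg (-X)
  rw [neg_neg] at h
  ext1 u
  change _ = weyl X (S ((weyl (-X) ∘L weyl X) (S' (weyl (-X) u))))
  rw [h]; rfl

theorem conjWeyl_one (X : Phase n) : conjWeyl X 1 = 1 := weyl_comp_neg X

theorem conjWeyl_map_add (X : Phase n) (S S' : L2 n →L[ℂ] L2 n) :
    conjWeyl X (S + S') = conjWeyl X S + conjWeyl X S' := by
  simp only [conjWeyl, ContinuousLinearMap.add_comp, ContinuousLinearMap.comp_add]

theorem conjWeyl_map_sub (X : Phase n) (S S' : L2 n →L[ℂ] L2 n) :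
    conjWeyl X (S - S') = conjWeyl X S - conjWeyl X S' := by
  simp only [conjWeyl, ContinuousLinearMap.sub_comp, ContinuousLinearMap.comp_sub]

theorem conjWeyl_smul (X : Phase n) (c : ℂ) (S : L2 n →L[ℂ] L2 n) :
    conjWeyl X (c • S) = c • conjWeyl X S := by
  simp only [conjWeyl, ContinuousLinearMap.smul_comp, ContinuousLinearMap.comp_smul]

theorem norm_conjWeyl_le (X : Phase n) (S : L2 n →L[ℂ] L2 n) : ‖conjWeyl X S‖ ≤ ‖S‖ := by
  calc ‖conjWeyl X S‖ ≤ ‖weyl X‖ * (‖S‖ * ‖weyl (-X)‖) :=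
        (ContinuousLinearMap.opNorm_comp_le _ _).trans
          (by gcongr; exact ContinuousLinearMap.opNorm_comp_le _ _)
    _ ≤ 1 * (‖S‖ * 1) := by gcongr <;> exact norm_weyl_le _
    _ = ‖S‖ := by ring

/-- Norm continuity at the origin of `X ↦ T_X(S)` suffices for `S ∈ B⁰`. -/
theorem mem_B0_of_tendsto {S : L2 n →L[ℂ] L2 n} {K : Phase n → ℝ}
    (hK : Tendsto K (𝓝 0) (𝓝 0)) (h : ∀ X, ‖conjWeyl X S - S‖ ≤ K X) : S ∈ B0 n := by
  refine continuous_iff_continuousAt.2 fun X => ?_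
  rw [ContinuousAt, tendsto_iff_norm_sub_tendsto_zero]
  have hlim : Tendsto (fun Y : Phase n => K (Y - X)) (𝓝 X) (𝓝 0) := by
    refine hK.comp ?_
    have : Continuous fun Y : Phase n => Y - X := by fun_prop
    simpa using this.tendsto X
  refine squeeze_zero (fun _ => norm_nonneg _) (fun Y => ?_) hlim
  -- `T_Y S - T_X S = T_X (T_{Y-X} S - S)`, and `T_X` is a contraction.
  rw [← add_sub_cancel X Y, conjWeyl_add, ← conjWeyl_map_sub, add_sub_cancel]
  exact (norm_conjWeyl_le _ _).trans (h _)

/-- If `(T + 1)⁻¹` is in `B⁰`, then so are all resolvents of `T`. -/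
theorem IsResolventAt.mem_B0 {T : L2 n →ₗ.[ℂ] L2 n} {R S : L2 n →L[ℂ] L2 n} {z : ℂ}
    (hT : ∀ u f, (u, f) ∈ T.graph ↔ u = R (f + u)) (hS : IsResolventAt T z S) (hR : R ∈ B0 n) :
    S ∈ B0 n := by
  have h1 := hS.eq_add hT
  have h2 := hS.eq_add' hT
  by_cases hz : 1 + z = 0
  · rw [hz, zero_smul, add_zero] at h1
    rwa [h1]
  set w := 1 + z
  -- The resolvent identities say that `1 + w S` inverts `1 - w R`. As `T_X` is multiplicative and
  -- unital, `T_X(1 + w S)` is the inverse of `T_X(1 - w R)`, and inversion is norm continuous on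
  -- units. Dividing by `w ≠ 0` recovers `T_X(S)`.
  have e1 : (1 - w • R) * (1 + w • S) = 1 := by
    have : (1 - w • R) * (1 + w • S) = 1 + w • (S - (R + w • (R * S))) := by
      simp only [sub_mul, mul_add, one_mul, mul_one, smul_mul_assoc, mul_smul_comm]; module
    rw [this, ← h1, sub_self, smul_zero, add_zero]
  have e2 : (1 + w • S) * (1 - w • R) = 1 := by
    have : (1 + w • S) * (1 - w • R) = 1 + w • (S - (R + w • (S * R))) := by
      simp only [add_mul, mul_sub, one_mul, mul_one, smul_mul_assoc, mul_smul_comm]; module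
    rw [this, ← h2, sub_self, smul_zero, add_zero]
  let A : Phase n → (L2 n →L[ℂ] L2 n)ˣ := fun X =>
    ⟨conjWeyl X (1 - w • R), conjWeyl X (1 + w • S), by rw [← conjWeyl_mul, e1, conjWeyl_one],
      by rw [← conjWeyl_mul, e2, conjWeyl_one]⟩
  have hA : Continuous fun X => (A X : L2 n →L[ℂ] L2 n) := by
    have : (fun X => (A X : L2 n →L[ℂ] L2 n)) = fun X => 1 - w • conjWeyl X R := by
      ext1 X
      change conjWeyl X (1 - w • R) = _
      rw [conjWeyl_map_sub, conjWeyl_one, conjWeyl_smul]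
    rw [this]
    have hR' : Continuous fun X => conjWeyl X R := hR
    exact continuous_const.sub (hR'.const_smul w)
  have hinv : Continuous fun X => (↑(A X)⁻¹ : L2 n →L[ℂ] L2 n) := by
    refine continuous_iff_continuousAt.2 fun X => ?_
    have := (NormedRing.inverse_continuousAt (A X)).comp_of_eq hA.continuousAt rfl
    refine this.congr (Eventually.of_forall fun Y => ?_)
    exact Ring.inverse_unit (A Y)
  have : (fun X => conjWeyl X S) = fun X => w⁻¹ • ((↑(A X)⁻¹ : L2 n →L[ℂ] L2 n) - 1) := by
    ext1 X
    change _ = w⁻¹ • (conjWeyl X (1 + w • S) - 1)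
    rw [conjWeyl_map_add, conjWeyl_one, conjWeyl_smul, add_sub_cancel_left, smul_smul,
      inv_mul_cancel₀ hz, one_smul]
  change Continuous _
  rw [this]
  exact (hinv.sub continuous_const).const_smul (w⁻¹)

/-! ### The action of the Weyl operators on test functions -/

theorem weylFun_mem_testFunctions (X : Phase n) (u : testFunctions n) :
    weylFun X (u : Config n → ℂ) ∈ testFunctions n := by
  have hu : ContDiff ℝ ∞ (u : Config n → ℂ) := u.2.1
  constructor
  · have h1 : ContDiff ℝ ∞ fun y : Config n => inner ℝ (y - (1 / 2 : ℝ) • X.1) X.2 :=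
      (contDiff_id.sub contDiff_const).inner ℝ contDiff_const
    have h2 : ContDiff ℝ ∞ fun y : Config n =>
        ((inner ℝ (y - (1 / 2 : ℝ) • X.1) X.2 : ℝ) : ℂ) := Complex.ofRealCLM.contDiff.comp h1
    have h3 : ContDiff ℝ ∞ fun y : Config n => (u : Config n → ℂ) (y - X.1) :=
      hu.comp (contDiff_id.sub contDiff_const)
    exact (contDiff_const.mul h2).cexp.mul h3
  · have h : HasCompactSupport fun y : Config n => (u : Config n → ℂ) (y - X.1) := by
      simpa [sub_eq_add_neg, Function.comp_def] using
        u.2.2.comp_homeomorph (Homeomorph.addRight (-X.1))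
    exact h.mul_left

/-- The restriction of `W(X)` to the test functions. -/
noncomputable def weylTest (X : Phase n) : testFunctions n →ₗ[ℂ] testFunctions n where
  toFun u := ⟨weylFun X u, weylFun_mem_testFunctions X u⟩
  map_add' u v := by
    ext y; simp only [weylFun, Submodule.coe_add, Pi.add_apply]; ring
  map_smul' c u := by
    ext y
    simp only [weylFun, Submodule.coe_smul, Pi.smul_apply, smul_eq_mul, RingHom.id_apply]; ring

theorem coe_weylTest (X : Phase n) (u : testFunctions n) :
    (weylTest X u : Config n → ℂ) = weylFun X u := rfl

theorem coeFn_testToL2 (u : testFunctions n) : testToL2 n u =ᵐ[volume] (u : Config n → ℂ) :=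
  (u.2.1.continuous.memLp_of_hasCompactSupport u.2.2).coeFn_toLp

theorem testToL2_weylTest (X : Phase n) (u : testFunctions n) :
    testToL2 n (weylTest X u) = weyl X (testToL2 n u) := by
  refine Lp.ext ?_
  filter_upwards [coeFn_testToL2 (weylTest X u), coeFn_weyl X (testToL2 n u),
    weylFun_congr_ae X (coeFn_testToL2 u)] with y h1 h2 h3
  rw [h1, h2, h3, coe_weylTest]

theorem weylTest_weylTest_neg (X : Phase n) (u : testFunctions n) :
    weylTest X (weylTest (-X) u) = u := by
  ext y
  rw [coe_weylTest, coe_weylTest, weylFun_weylFun, add_neg_cancel, weylFun_zero]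
  simp

theorem partialDeriv_weylTest (X : Phase n) (j : Fin n) (u : testFunctions n) (y : Config n) :
    partialDeriv j (weylTest X u) y =
      Complex.exp (Complex.I * ((inner ℝ (y - (1 / 2 : ℝ) • X.1) X.2 : ℝ) : ℂ)) *
        (partialDeriv j u (y - X.1) + Complex.I * X.2 j * (u : Config n → ℂ) (y - X.1)) := by
  have hu : DifferentiableAt ℝ (u : Config n → ℂ) (y - X.1) :=
    (u.2.1.differentiable (by simp)).differentiableAt
  have h1 : HasFDerivAt (fun y : Config n => (u : Config n → ℂ) (y - X.1))
      (fderiv ℝ (u : Config n → ℂ) (y - X.1)) y := by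
    exact hu.hasFDerivAt.comp y ((hasFDerivAt_id y).sub_const X.1)
  have h2 : HasFDerivAt (fun y : Config n => (inner ℝ (y - (1 / 2 : ℝ) • X.1) X.2 : ℝ))
      (innerSL ℝ X.2) y := by
    have := ((innerSL ℝ X.2).hasFDerivAt (x := y - (1 / 2 : ℝ) • X.1)).comp y
      ((hasFDerivAt_id y).sub_const ((1 / 2 : ℝ) • X.1))
    exact HasFDerivAt.congr_of_eventuallyEq this
      (Eventually.of_forall fun z => real_inner_comm _ _)
  have h3 := ((Complex.ofRealCLM.hasFDerivAt.comp y h2).const_mul Complex.I).cexp.mul h1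
  have h4 : (weylTest X u : Config n → ℂ) = fun y => Complex.exp (Complex.I *
      ((inner ℝ (y - (1 / 2 : ℝ) • X.1) X.2 : ℝ) : ℂ)) * (u : Config n → ℂ) (y - X.1) := rfl
  rw [partialDeriv, h4]
  refine (DFunLike.congr_fun h3.fderiv (EuclideanSpace.single j 1)).trans ?_
  simp [partialDeriv, EuclideanSpace.inner_single_right]
  ring

/-! ### The pointwise energy -/

section Matrix

open Matrix

variable {ι : Type*} [Fintype ι]

/-- The real part of `⟨p, A p⟩`. -/
noncomputable def energy (A : Matrix ι ι ℂ) (p : ι → ℂ) : ℝ := (star p ⬝ᵥ A *ᵥ p).re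

theorem energy_eq_sum (A : Matrix ι ι ℂ) (p : ι → ℂ) :
    energy A p = (∑ j, ∑ k, A j k * conj (p j) * p k).re := by
  rw [energy]
  simp only [dotProduct, mulVec, Finset.mul_sum, Pi.star_apply, RCLike.star_def]
  congr 1
  exact Finset.sum_congr rfl fun j _ => Finset.sum_congr rfl fun k _ => by ring

theorem energy_smul (A : Matrix ι ι ℂ) (c : ℂ) (p : ι → ℂ) :
    energy A (c • p) = ‖c‖ ^ 2 * energy A p := by
  rw [energy, energy, mulVec_smul, star_smul, smul_dotProduct, dotProduct_smul, smul_smul,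
    RCLike.star_def, mul_comm, Complex.mul_conj, smul_eq_mul, Complex.re_ofReal_mul,
    Complex.normSq_eq_norm_sq]

theorem energy_nonneg {A : Matrix ι ι ℂ} (hA : A.PosSemidef) (p : ι → ℂ) : 0 ≤ energy A p :=
  (Complex.le_def.1 (hA.dotProduct_mulVec_nonneg p)).1

theorem energy_le_of_posSemidef_smul_sub {A B : Matrix ι ι ℂ} {c : ℝ}
    (h : ((c : ℂ) • A - B).PosSemidef) (p : ι → ℂ) : energy B p ≤ c * energy A p := by
  have := energy_nonneg h p
  rw [energy, sub_mulVec, smul_mulVec, dotProduct_sub, dotProduct_smul, Complex.sub_re,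
    smul_eq_mul, Complex.re_ofReal_mul] at this
  exact sub_nonneg.1 this

theorem energy_one [DecidableEq ι] (p : ι → ℂ) : energy 1 p = ∑ j, ‖p j‖ ^ 2 := by
  simp only [energy, one_mulVec, dotProduct, Pi.star_apply, RCLike.star_def, Complex.re_sum]
  refine Finset.sum_congr rfl fun j _ => ?_
  rw [mul_comm, Complex.mul_conj, Complex.normSq_eq_norm_sq, Complex.ofReal_re]

/-- Expanding `s · energy A (p - q) ≥ 0` bounds the cross terms. The weight `s` is chosen so that,
as `s → 0`, the coefficient of `energy A p` tends to `1` and that of `energy A q` to `0`. -/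
theorem energy_add_smul_le {A : Matrix ι ι ℂ} (hA : A.PosSemidef) {s : ℝ} (hs : 0 ≤ s)
    (p q : ι → ℂ) :
    energy A (p + (s : ℂ) • q) ≤ (1 + s) * energy A p + (s + s ^ 2) * energy A q := by
  have h := mul_nonneg hs (energy_nonneg hA (p - q))
  simp only [energy, star_add, star_sub, star_smul, mulVec_add, mulVec_sub, mulVec_smul,
    add_dotProduct, sub_dotProduct, dotProduct_add, dotProduct_sub, dotProduct_smul,
    smul_dotProduct, RCLike.star_def, Complex.conj_ofReal, smul_eq_mul, Complex.add_re,
    Complex.sub_re, Complex.re_ofReal_mul] at h ⊢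
  linarith

end Matrix

theorem quadForm_eq_integral_energy (a : CoeffField n) (u : testFunctions n) :
    quadForm a u = ∫ x, energy (a x) fun j => partialDeriv j u x := by
  simp only [energy_eq_sum]
  exact (integral_re (integrable_sesqForm a u u)).symm

theorem integrable_energy (a : CoeffField n) (u : testFunctions n) :
    Integrable (fun x => energy (a x) fun j => partialDeriv j u x) volume := by
  simp only [energy_eq_sum]
  exact (integrable_sesqForm a u u).re

theorem integrable_norm_sq (u : testFunctions n) :
    Integrable (fun x => ‖(u : Config n → ℂ) x‖ ^ 2) volume :=
  (u.2.1.continuous.memLp_of_hasCompactSupport u.2.2 (p := 2)).integrable_norm_pow (by simp)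

theorem norm_testToL2_sq (u : testFunctions n) :
    ‖testToL2 n u‖ ^ 2 = ∫ x, ‖(u : Config n → ℂ) x‖ ^ 2 := by
  rw [← inner_self_eq_norm_sq (𝕜 := ℂ), L2.inner_def, ← integral_re (L2.integrable_inner _ _)]
  refine integral_congr_ae ?_
  filter_upwards [coeFn_testToL2 u] with x hx
  rw [inner_self_eq_norm_sq, hx]

/-- The bound on `‖W(X)‖²` as an operator on the form domain. -/
noncomputable def weylBound (c' : ℝ) (C : Config n → ℝ) (X : Phase n) : ℝ :=
  max (C X.1) 1 * (1 + ‖X.2‖) + C X.1 * (‖X.2‖ + ‖X.2‖ ^ 2) * |c'|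

theorem continuous_weylBound (c' : ℝ) {C : Config n → ℝ} (hC : Continuous C) :
    Continuous (weylBound c' C) := by
  unfold weylBound; fun_prop

theorem weylBound_zero (c' : ℝ) {C : Config n → ℝ} (hC : C 0 = 1) : weylBound c' C 0 = 1 := by
  simp [weylBound, hC]

theorem one_le_weylBound (c' : ℝ) {C : Config n → ℝ} (hC : ∀ x, 0 < C x) (X : Phase n) :
    1 ≤ weylBound c' C X := by
  have h1 : 1 * 1 ≤ max (C X.1) 1 * (1 + ‖X.2‖) := by
    gcongr
    · exact le_max_right _ _
    · linarith [norm_nonneg X.2]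
  have h2 : 0 ≤ C X.1 * (‖X.2‖ + ‖X.2‖ ^ 2) * |c'| := by have := (hC X.1).le; positivity
  rw [weylBound]; linarith

/-- The unimodular phase drops out of the energy. Splitting `ξ` as `‖ξ‖` times a vector of norm at
most one (zero when `ξ = 0`) isolates the small parameter `s = ‖ξ‖` for `energy_add_smul_le`. -/
theorem energy_partialDeriv_weylTest (A : Matrix (Fin n) (Fin n) ℂ) (X : Phase n)
    (u : testFunctions n) (y : Config n) :
    energy A (fun j => partialDeriv j (weylTest X u) (y + X.1)) =
      energy A ((fun j => partialDeriv j u y) + (‖X.2‖ : ℂ) •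
        fun j => Complex.I * ((‖X.2‖⁻¹ • X.2) j : ℝ) * (u : Config n → ℂ) y) := by
  have h : (fun j => partialDeriv j (weylTest X u) (y + X.1)) =
      Complex.exp (Complex.I * ((inner ℝ (y + X.1 - (1 / 2 : ℝ) • X.1) X.2 : ℝ) : ℂ)) •
        ((fun j => partialDeriv j u y) + (‖X.2‖ : ℂ) •
        fun j => Complex.I * ((‖X.2‖⁻¹ • X.2) j : ℝ) * (u : Config n → ℂ) y) := by
    ext j
    rw [partialDeriv_weylTest, add_sub_cancel_right]
    simp only [Pi.smul_apply, Pi.add_apply, smul_eq_mul]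
    congr 2
    have h2 : X.2 j = ‖X.2‖ * (‖X.2‖⁻¹ • X.2) j := by
      rcases eq_or_ne X.2 0 with h0 | h0
      · simp [h0]
      · rw [PiLp.smul_apply, smul_eq_mul, mul_inv_cancel_left₀ (norm_ne_zero_iff.2 h0)]
    have h3 : (X.2 j : ℂ) = ‖X.2‖ * ((‖X.2‖⁻¹ • X.2) j : ℝ) := by
      rw [← Complex.ofReal_mul, ← h2]
    rw [h3]
    ring
  rw [h, energy_smul, mul_comm Complex.I, Complex.norm_exp_ofReal_mul_I, one_pow, one_mul]

section Bound

variable {a : CoeffField n} {c' : ℝ} {C : Config n → ℝ}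

theorem energy_weylTest_le
    (hbound : ∀ᵐ x ∂(volume : Measure (Config n)),
      ((c' : ℂ) • (1 : Matrix (Fin n) (Fin n) ℂ) - a x).PosSemidef)
    (hCpos : ∀ x, 0 < C x) (X : Phase n)
    (hC : ∀ᵐ z ∂(volume : Measure (Config n)), ((C X.1 : ℂ) • a z - a (z + X.1)).PosSemidef)
    (u : testFunctions n) :
    ∀ᵐ y ∂(volume : Measure (Config n)),
      energy (a (y + X.1)) (fun j => partialDeriv j (weylTest X u) (y + X.1)) ≤
        C X.1 * (1 + ‖X.2‖) * energy (a y) (fun j => partialDeriv j u y) +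
          C X.1 * (‖X.2‖ + ‖X.2‖ ^ 2) * |c'| * ‖(u : Config n → ℂ) y‖ ^ 2 := by
  filter_upwards [hbound, hC, a.posDef] with y h1 h2 h3
  rw [energy_partialDeriv_weylTest]
  set q : Fin n → ℂ := fun j => Complex.I * ((‖X.2‖⁻¹ • X.2) j : ℝ) * (u : Config n → ℂ) y
  have hq : energy (a y) q ≤ |c'| * ‖(u : Config n → ℂ) y‖ ^ 2 := by
    have e1 : energy 1 q = ‖‖X.2‖⁻¹ • X.2‖ ^ 2 * ‖(u : Config n → ℂ) y‖ ^ 2 := by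
      rw [energy_one, EuclideanSpace.norm_sq_eq, Finset.sum_mul]
      refine Finset.sum_congr rfl fun j _ => ?_
      rw [norm_mul, norm_mul, Complex.norm_I, one_mul, Complex.norm_real, mul_pow]
    have e2 : ‖‖X.2‖⁻¹ • X.2‖ ≤ 1 := by
      rw [norm_smul, norm_inv, norm_norm]; exact inv_mul_le_one
    calc energy (a y) q ≤ c' * energy 1 q := energy_le_of_posSemidef_smul_sub h1 q
      -- The sign of `c'` is not known: for `n = 0` the matrix bound holds for every real `c'`.
      _ ≤ |c'| * energy 1 q := by
        have : 0 ≤ energy 1 q := by rw [e1]; positivity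
        gcongr; exact le_abs_self _
      _ ≤ |c'| * (1 ^ 2 * ‖(u : Config n → ℂ) y‖ ^ 2) := by rw [e1]; gcongr
      _ = _ := by ring
  have hpos := (hCpos X.1).le
  calc _ ≤ C X.1 * energy (a y) _ := energy_le_of_posSemidef_smul_sub h2 _
    _ ≤ C X.1 * ((1 + ‖X.2‖) * energy (a y) (fun j => partialDeriv j u y)
        + (‖X.2‖ + ‖X.2‖ ^ 2) * energy (a y) q) := by
      gcongr; exact energy_add_smul_le h3.posSemidef (norm_nonneg _) _ _
    _ ≤ C X.1 * ((1 + ‖X.2‖) * energy (a y) (fun j => partialDeriv j u y)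
        + (‖X.2‖ + ‖X.2‖ ^ 2) * (|c'| * ‖(u : Config n → ℂ) y‖ ^ 2)) := by gcongr
    _ = _ := by ring

theorem quadForm_weylTest_le
    (hbound : ∀ᵐ x ∂(volume : Measure (Config n)),
      ((c' : ℂ) • (1 : Matrix (Fin n) (Fin n) ℂ) - a x).PosSemidef)
    (hCpos : ∀ x, 0 < C x) (X : Phase n)
    (hC : ∀ᵐ z ∂(volume : Measure (Config n)), ((C X.1 : ℂ) • a z - a (z + X.1)).PosSemidef)
    (u : testFunctions n) :
    quadForm a (weylTest X u) ≤ C X.1 * (1 + ‖X.2‖) * quadForm a u +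
      C X.1 * (‖X.2‖ + ‖X.2‖ ^ 2) * |c'| * ‖testToL2 n u‖ ^ 2 := by
  rw [quadForm_eq_integral_energy, quadForm_eq_integral_energy, norm_testToL2_sq,
    ← integral_const_mul, ← integral_const_mul,
    ← integral_add ((integrable_energy a u).const_mul _) ((integrable_norm_sq u).const_mul _),
    -- Translating the variable by `x` puts the left side in the form `a(y + x)`, to which the
    -- comparison hypothesis applies pointwise.
    ← integral_add_right_eq_self _ X.1]
  exact integral_mono_ae ((integrable_energy a (weylTest X u)).comp_add_right X.1)
    (((integrable_energy a u).const_mul _).add ((integrable_norm_sq u).const_mul _))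
    (energy_weylTest_le hbound hCpos X hC u)

theorem norm_weylTest_sq_le
    (hbound : ∀ᵐ x ∂(volume : Measure (Config n)),
      ((c' : ℂ) • (1 : Matrix (Fin n) (Fin n) ℂ) - a x).PosSemidef)
    (hCpos : ∀ x, 0 < C x) (X : Phase n)
    (hC : ∀ᵐ z ∂(volume : Measure (Config n)), ((C X.1 : ℂ) • a z - a (z + X.1)).PosSemidef)
    (u : FormCore a) :
    ‖(FormCore.toTest a).symm (weylTest X (FormCore.toTest a u))‖ ^ 2 ≤
      weylBound c' C X * ‖u‖ ^ 2 := by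
  rw [formCore_norm_sq, formCore_norm_sq, LinearEquiv.apply_symm_apply, testToL2_weylTest,
    norm_weyl_apply]
  have h := quadForm_weylTest_le hbound hCpos X hC (FormCore.toTest a u)
  set q := quadForm a (FormCore.toTest a u)
  set m := ‖testToL2 n (FormCore.toTest a u)‖ ^ 2
  have hq : 0 ≤ q := quadForm_nonneg a _
  have hm : 0 ≤ m := sq_nonneg _
  have hs := norm_nonneg X.2
  have hpos := (hCpos X.1).le
  calc _ ≤ C X.1 * (1 + ‖X.2‖) * q + C X.1 * (‖X.2‖ + ‖X.2‖ ^ 2) * |c'| * m + 1 * 1 * m := by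
        linarith
    -- The `L²` part is preserved with coefficient `1`, whereas `C x` may be smaller than `1`; the
    -- maximum dominates both coefficients.
    _ ≤ max (C X.1) 1 * (1 + ‖X.2‖) * q + C X.1 * (‖X.2‖ + ‖X.2‖ ^ 2) * |c'| * (q + m) +
        max (C X.1) 1 * (1 + ‖X.2‖) * m := by
      gcongr
      · exact le_max_left _ _
      · linarith
      · exact le_max_right _ _
      · linarith
    _ = _ := by rw [weylBound]; ring

end Bound

/-! ### The action of the Weyl operators on the form domain -/

theorem formEmbedding_ext {a : CoeffField n} {E : Type*} [NormedAddCommGroup E] [NormedSpace ℂ E]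
    {S T : FormSpace a →L[ℂ] E} (h : ∀ u : FormCore a, S u = T u) : S = T := by
  refine ContinuousLinearMap.ext fun g => ?_
  induction g using UniformSpace.Completion.induction_on with
  | hp => exact isClosed_eq S.continuous T.continuous
  | ih u => exact h u

theorem norm_formEmbedding_le (a : CoeffField n) : ‖formEmbedding a‖ ≤ 1 := by
  refine ContinuousLinearMap.opNorm_le_bound _ zero_le_one fun g => ?_
  induction g using UniformSpace.Completion.induction_on with
  | hp => exact isClosed_le (by fun_prop) (by fun_prop)
  | ih u =>
    rw [formEmbedding_coe, UniformSpace.Completion.norm_coe]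
    exact (coreToL2 a).le_of_opNorm_le (LinearMap.mkContinuous_norm_le _ zero_le_one _) u

/-- If `W(X)` is bounded for the form norm on test functions, it extends to the form domain. -/
theorem exists_formSpace_weyl {a : CoeffField n} {X : Phase n} {M : ℝ} (hM : 0 ≤ M)
    (h : ∀ u : FormCore a,
      ‖(FormCore.toTest a).symm (weylTest X (FormCore.toTest a u))‖ ^ 2 ≤ M * ‖u‖ ^ 2) :
    ∃ V : FormSpace a →L[ℂ] FormSpace a, ‖V‖ ^ 2 ≤ M ∧ ∀ u : FormCore a,
      V u = ((FormCore.toTest a).symm (weylTest X (FormCore.toTest a u)) : FormCore a) := by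
  let V₀ : FormCore a →L[ℂ] FormSpace a :=
    LinearMap.mkContinuous ((UniformSpace.Completion.toComplL (𝕜 := ℂ)).toLinearMap ∘ₗ
      (FormCore.toTest a).symm.toLinearMap ∘ₗ weylTest X ∘ₗ (FormCore.toTest a).toLinearMap)
      (√M) (fun u => by
        refine (UniformSpace.Completion.norm_coe _).trans_le ?_
        refine abs_le_of_sq_le_sq' ?_ (by positivity) |>.2
        rw [mul_pow, Real.sq_sqrt hM]
        exact h u)
  have hV : ∀ u : FormCore a, V₀.fromCompletion u =
      ((FormCore.toTest a).symm (weylTest X (FormCore.toTest a u)) : FormCore a) :=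
    V₀.fromCompletion_apply_coe
  refine ⟨V₀.fromCompletion, ?_, hV⟩
  have hn : ‖V₀.fromCompletion‖ ≤ √M := by
    refine ContinuousLinearMap.opNorm_le_bound _ (Real.sqrt_nonneg _) fun g => ?_
    induction g using UniformSpace.Completion.induction_on with
    | hp => exact isClosed_le (by fun_prop) (by fun_prop)
    | ih u =>
      rw [V₀.fromCompletion_apply_coe, UniformSpace.Completion.norm_coe]
      exact V₀.le_of_opNorm_le (LinearMap.mkContinuous_norm_le _ (Real.sqrt_nonneg _) _) u
  calc _ ≤ √M ^ 2 := by gcongr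
    _ = M := Real.sq_sqrt hM

/-! ### The operator -/

open ContinuousLinearMap in
/-- The resolvent `(H_a + 1)⁻¹ = J J*`, with `J` the embedding of the form domain. -/
noncomputable def formResolvent (a : CoeffField n) : L2 n →L[ℂ] L2 n :=
  formEmbedding a ∘L adjoint (formEmbedding a)

theorem isSelfAdjoint_formResolvent (a : CoeffField n) : IsSelfAdjoint (formResolvent a) := by
  rw [ContinuousLinearMap.isSelfAdjoint_iff', formResolvent, ContinuousLinearMap.adjoint_comp,
    ContinuousLinearMap.adjoint_adjoint]

theorem denseRange_testToL2 : DenseRange (testToL2 n) := by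
  refine (Lp.dense_hasCompactSupport_contDiff (F := ℂ) (μ := (volume : Measure (Config n)))
    (p := 2) (by simp)).mono ?_
  rintro f ⟨g, hfg, hg1, hg2⟩
  exact ⟨⟨g, hg2, hg1⟩, Lp.ext ((coeFn_testToL2 _).trans hfg.symm)⟩

-- If `J J* f = 0` then `‖J* f‖² = 0`, so `f` is orthogonal to the range of `J`, which contains the
-- dense set of test functions.
open ContinuousLinearMap in
theorem injective_formResolvent (a : CoeffField n) : Function.Injective (formResolvent a) := by
  rw [injective_iff_map_eq_zero]
  intro f hf
  have h1 : adjoint (formEmbedding a) f = 0 := by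
    rw [← inner_self_eq_zero (𝕜 := ℂ), adjoint_inner_right]
    change inner ℂ (formResolvent a f) f = 0
    rw [hf, inner_zero_left]
  refine denseRange_testToL2.eq_zero_of_inner_right ℂ ?_
  intro u
  have h2 := formEmbedding_coe a ((FormCore.toTest a).symm u)
  rw [LinearEquiv.apply_symm_apply] at h2
  rw [← h2, ← adjoint_inner_right, h1, inner_zero_right]

-- Adding `⟨J h, u⟩` to both sides turns `q_a(h, g) = ⟨J h, f⟩` with `J g = u` into `⟨h, g⟩_a = ⟨J
-- h, f + u⟩`, that is, `g = J* (f + u)`. Applying `J` gives the resolvent equation.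
open ContinuousLinearMap in
theorem mem_operatorGraph_iff (a : CoeffField n) (u f : L2 n) :
    (u, f) ∈ operatorGraph a ↔ u = formResolvent a (f + u) := by
  have key : ∀ g : FormSpace a, formEmbedding a g = u →
      ((∀ h, closedForm a h g = inner ℂ (formEmbedding a h) f) ↔
        g = adjoint (formEmbedding a) (f + u)) := by
    intro g hg
    constructor
    · intro H
      refine ext_inner_left ℂ fun h => ?_
      rw [adjoint_inner_right, inner_add_right, ← H h, closedForm, hg, sub_add_cancel]
    · intro H h
      rw [closedForm, hg, sub_eq_iff_eq_add, ← inner_add_right, ← adjoint_inner_right, ← H]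
  constructor
  · rintro ⟨g, hg, H⟩
    simp only at hg H
    rw [formResolvent, comp_apply, ← (key g hg).1 H, hg]
  · intro h
    exact ⟨adjoint (formEmbedding a) (f + u), h.symm, (key _ h.symm).2 rfl⟩

theorem mem_graph_ellipticOperator_iff (a : CoeffField n) (u f : L2 n) :
    (u, f) ∈ (ellipticOperator a).graph ↔ u = formResolvent a (f + u) := by
  rw [ellipticOperator, Submodule.toLinearPMap_graph_eq, mem_operatorGraph_iff]
  -- The relation must be single-valued to be the graph of an operator: `(0, y)` in it forces `J J*
  -- y = 0`, hence `y = 0`.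
  rintro ⟨x, y⟩ hx hx'
  simp only at hx'
  rw [hx', mem_operatorGraph_iff, add_zero] at hx
  exact injective_formResolvent a (by rw [← hx, map_zero])

-- The intertwining relation and its adjoint, with `W(X)* = W(-X)`, move the Weyl operators inside:
-- `W(X) J J* W(-X) = J V V* J*`. As `J` is a contraction, only `V V* - 1` remains to be estimated.
open ContinuousLinearMap in
theorem norm_conjWeyl_formResolvent_sub_le {a : CoeffField n} {X : Phase n}
    {V U : FormSpace a →L[ℂ] FormSpace a} (hV : formEmbedding a ∘L V = weyl X ∘L formEmbedding a)
    (hVU : V ∘L U = 1) {K : ℝ} (hK : 0 ≤ K) (hVK : ‖V‖ ^ 2 ≤ 1 + K) (hUK : ‖U‖ ^ 2 ≤ 1 + K) :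
    ‖conjWeyl X (formResolvent a) - formResolvent a‖ ≤ K := by
  have h1 : conjWeyl X (formResolvent a) - formResolvent a =
      formEmbedding a ∘L (V ∘L adjoint V - 1) ∘L adjoint (formEmbedding a) := by
    have h2 : adjoint (formEmbedding a) ∘L weyl (-X) = adjoint V ∘L adjoint (formEmbedding a) := by
      rw [← adjoint_weyl, ← adjoint_comp, ← adjoint_comp, hV]
    have h3 : conjWeyl X (formResolvent a) =
        formEmbedding a ∘L (V ∘L adjoint V) ∘L adjoint (formEmbedding a) := by
      rw [comp_assoc, ← h2, ← comp_assoc, hV]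
      rfl
    rw [h3, sub_comp, comp_sub]
    rfl
  have hJ := norm_formEmbedding_le a
  rw [h1]
  calc _ ≤ ‖formEmbedding a‖ * (‖V ∘L adjoint V - 1‖ * ‖adjoint (formEmbedding a)‖) :=
        (opNorm_comp_le _ _).trans (by gcongr; exact opNorm_comp_le _ _)
    _ ≤ 1 * (K * 1) := by
      rw [LinearIsometryEquiv.norm_map]
      gcongr
      exact norm_comp_adjoint_sub_one_le hVU hK hVK hUK
    _ = K := by ring

end PhaseSpace

open PhaseSpace in
/-- Closability makes `formEmbedding a` injective, so that `𝒢_a` is a subspace of `L²`. The argument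
below goes through `(H_a + 1)⁻¹ = J J*`, which needs only the density of the test functions. -/
theorem proposition7p1 (n : ℕ) (a : PhaseSpace.CoeffField n)
    (hclosable : PhaseSpace.IsClosable a)
    (c' : ℝ)
    (hbound : ∀ᵐ x ∂(volume : Measure (PhaseSpace.Config n)),
      ((c' : ℂ) • (1 : Matrix (Fin n) (Fin n) ℂ) - a x).PosSemidef)
    (C : PhaseSpace.Config n → ℝ) (hCcont : Continuous C) (hCpos : ∀ x, 0 < C x)
    (hCzero : C 0 = 1)
    (hC : ∀ x : PhaseSpace.Config n, ∀ᵐ z ∂(volume : Measure (PhaseSpace.Config n)),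
      ((C x : ℂ) • a z - a (z + x)).PosSemidef) :
    (∀ X : PhaseSpace.Phase n, ∀ u ∈ PhaseSpace.formDomain a,
      PhaseSpace.weyl X u ∈ PhaseSpace.formDomain a) ∧
    PhaseSpace.IsAffiliated (PhaseSpace.ellipticOperator a) (PhaseSpace.B0 n) := by
  have hone : ∀ X : Phase n, 1 ≤ weylBound c' C X := one_le_weylBound c' hCpos
  choose V hVnorm hVcoe using fun X : Phase n =>
    exists_formSpace_weyl (zero_le_one.trans (hone X))
      (norm_weylTest_sq_le (a := a) hbound hCpos X (hC X.1))
  have hVJ : ∀ X, formEmbedding a ∘L V X = weyl X ∘L formEmbedding a := fun X =>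
    formEmbedding_ext fun u => by
      rw [ContinuousLinearMap.comp_apply, ContinuousLinearMap.comp_apply, hVcoe, formEmbedding_coe,
        formEmbedding_coe, LinearEquiv.apply_symm_apply, testToL2_weylTest]
  have hVV : ∀ X, V X ∘L V (-X) = 1 := fun X =>
    formEmbedding_ext fun u => by
      rw [ContinuousLinearMap.comp_apply, hVcoe, hVcoe, LinearEquiv.apply_symm_apply,
        weylTest_weylTest_neg, LinearEquiv.symm_apply_apply]
      rfl
  have hB0 : formResolvent a ∈ B0 n := by
    -- The maximum over `X` and `-X` appears because the right inverse of `V X` is `V (-X)`, and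
    -- both norms must be controlled. The modulus vanishes at `0` since `C 0 = 1`.
    refine mem_B0_of_tendsto (K := fun X => max (weylBound c' C X) (weylBound c' C (-X)) - 1)
      ?_ fun X => ?_
    · have h := continuous_weylBound c' hCcont
      have hc : Continuous fun X : Phase n =>
          max (weylBound c' C X) (weylBound c' C (-X)) - 1 :=
        (h.max (h.comp continuous_neg)).sub continuous_const
      simpa [weylBound_zero c' hCzero] using hc.tendsto 0
    · refine norm_conjWeyl_formResolvent_sub_le (hVJ X) (hVV X) ?_ ?_ ?_
      · exact sub_nonneg.2 ((hone X).trans (le_max_left _ _))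
      · rw [add_sub_cancel]
        exact (hVnorm X).trans (le_max_left _ _)
      · rw [add_sub_cancel]
        exact (hVnorm (-X)).trans (le_max_right _ _)
  refine ⟨?_, isSelfAdjoint_of_graph (isSelfAdjoint_formResolvent a) (injective_formResolvent a)
    (mem_graph_ellipticOperator_iff a), fun z hz => exists_isResolventAt
      (isSelfAdjoint_formResolvent a) (mem_graph_ellipticOperator_iff a) hz, fun z R hR =>
      hR.mem_B0 (mem_graph_ellipticOperator_iff a) hB0⟩
  rintro X _ ⟨g, rfl⟩
  exact ⟨V X g, DFunLike.congr_fun (hVJ X) g⟩
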